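/- Let $Q$ be a smooth finite-dimensional manifold (without boundary). A discretization map on $Q$ is a smooth map $R_d=(R^1,R^2):U\to Q\times Q$, defined on an open neighbourhood $U\subset TQ$ of the zero section, such that $R_d(0_q)=(q,q)$ and $T_{0_q}(R^2|_{T_qQ})-T_{0_q}(R^1|_{T_qQ})=\mathrm{id}_{T_qQ}$ for all $q\in Q$. Its cotangent lift is $$R_d^{T^*}=\Phi^{-1}\circ\widehat{R_d}\circ\alpha_Q ,$$ with values in $T^*Q\times T^*Q$, where $\alpha_Q:TT^*Q\to T^*TQ$ is the canonical isomorphism, $(q,p,\dot q,\dot p)\mapsto(q,\dot q,\dot p,p)$ in natural coordinates; $\widehat{R_d}(\beta_x)=\beta_x\circ(T_xR_d)^{-1}\in T^*_{R_d(x)}(Q\times Q)$ for $\beta_x\in T_x^*TQ$; and $\Phi:T^*Q\times T^*Q\to T^*(Q\times Q)$, $(q_0,p_0;q_1,p_1)\mapsto(q_0,q_1,-p_0,p_1)$. It is defined at those $w\in TT^*Q$ for which $x=T\pi_Q(w)$ lies in $U$ and $T_xR_d$ is invertible, where $\pi_Q:T^*Q\to Q$ is the projection. Let $H:T^*Q\to\mathbb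 R$ be smooth, with Hamiltonian vector field $X_H$ given by $i_{X_H}\omega_Q=dH$, where $\omega_Q=-d\theta_Q$ is the canonical symplectic form. For $h\in\mathbb R$ put $$\mathcal L^h=\{(\alpha,\beta)\in T^*Q\times T^*Q \mid \exists\,\gamma\in T^*Q:\ h X_H(\gamma)\in\operatorname{dom}R_d^{T^*}\ \text{and}\ (\alpha,\beta)=R_d^{T^*}(h X_H(\gamma))\},$$ and, for $\mathcal L\subset T^*Q\times T^*Q$, let $\mathcal L^\dagger=\{(\alpha,\beta)\mid(\beta,\alpha)\in\mathcal L\}$. Let $\iota(q,q')=(q',q)$ on $Q\times Q$. If for every $v_q\in U$ one has $-v_q\in U$ and $R_d(v_q)=\iota(R_d(-v_q))$, then the method defined by $\mathcal L^h$ is symmetric: $(\mathcal L^h)^\dagger=\mathcal L^{-h}$ for every $h\in\mathbb R$. -/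

import Mathlib

open scoped Manifold ContDiff Topology
open Bundle Set

noncomputable section

section General

variable {E : Type*} [NormedAddCommGroup E] [NormedSpace ℝ E]
  {H : Type*} [TopologicalSpace H] (I : ModelWithCorners ℝ E H)
  {E' : Type*} [NormedAddCommGroup E'] [NormedSpace ℝ E']
  {H' : Type*} [TopologicalSpace H'] (I' : ModelWithCorners ℝ E' H')

/-- The model with corners of the cotangent bundle. -/
abbrev ModelWithCorners.cotangent : ModelWithCorners ℝ (E × (E →L[ℝ] ℝ)) (ModelProd H (E →L[ℝ] ℝ)) :=
  I.prod 𝓘(ℝ, E →L[ℝ] ℝ)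

/-- The cotangent bundle `T^*M`: the bundle of continuous linear forms on the tangent spaces, with
Mathlib's topology and smooth structure of a hom bundle. -/
abbrev CotangentBundle (M : Type*) [TopologicalSpace M] [ChartedSpace H M] :=
  TotalSpace (E →L[ℝ] ℝ) (fun x : M => TangentSpace I x →L[ℝ] ℝ)

variable {M : Type*} [TopologicalSpace M] [ChartedSpace H M]
  {N : Type*} [TopologicalSpace N] [ChartedSpace H' N]

/-- Fibrewise multiplication by `c` in a tangent bundle, `v_x ↦ c v_x`. -/
def TangentBundle.smulFiber (c : ℝ) (v : TangentBundle I M) : TangentBundle I M :=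
  ⟨v.proj, c • v.snd⟩

/-- Fibrewise negation in a tangent bundle, `v_x ↦ - v_x`. -/
def TangentBundle.negFiber (v : TangentBundle I M) : TangentBundle I M :=
  ⟨v.proj, -v.snd⟩

/-- `R : U ⊆ TM → M × M` is a discretization map: it is defined and smooth on the open neighbourhood
`U` of the zero section, `R (0_x) = (x, x)`, and `T_{0_x} R²_x - T_{0_x} R¹_x = id` on `T_x M`, where
`R^a_x` is the restriction of the `a`-th component of `R` to `T_x M` (whose model space is `E`).
The values of `R` outside `U` are irrelevant. -/
structure IsDiscretizationMap [IsManifold I 1 M] (U : Set (TangentBundle I M))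
    (R : TangentBundle I M → M × M) : Prop where
  isOpen : IsOpen U
  zero_mem : ∀ x : M, (⟨x, 0⟩ : TangentBundle I M) ∈ U
  contMDiffOn : ContMDiffOn I.tangent (I.prod I) ∞ R U
  map_zero : ∀ x : M, R ⟨x, 0⟩ = (x, x)
  deriv_sub : ∀ x : M,
    let D₁ : E →L[ℝ] E := mfderiv 𝓘(ℝ, E) I (fun v : E => (R ⟨x, v⟩).1) 0
    let D₂ : E →L[ℝ] E := mfderiv 𝓘(ℝ, E) I (fun v : E => (R ⟨x, v⟩).2) 0
    D₂ - D₁ = ContinuousLinearMap.id ℝ E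

/-- The cotangent lift `F̂ = T^*F⁻¹ : T^*M → T^*N` of (the inverse of) a local diffeomorphism `F`:
`F̂ (α_x) = α_x ∘ (T_x F)⁻¹ ∈ T^*_{F x} N`. It is meaningful at the covectors `α_x` for which
`T_x F` is invertible. -/
def cotangentLift (F : M → N) (a : CotangentBundle I M) : CotangentBundle I' N :=
  ⟨F a.proj, a.snd.comp (mfderiv I I' F a.proj).inverse⟩

/-- The exterior derivative at `x` of the one-form `θ` on `M`, as a bilinear form on `T_x M`.
In the chart `φ` at `x`, the form is `Θ y = θ (φ⁻¹ y) ∘ T_y φ⁻¹`, whose exterior derivative at `φ x`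
is `(u, v) ↦ D Θ u v - D Θ v u`; this is pulled back to `T_x M` along `T_x φ`. -/
def oneFormExtDeriv (θ : ∀ x : M, TangentSpace I x →L[ℝ] ℝ) (x : M) :
    TangentSpace I x →L[ℝ] TangentSpace I x →L[ℝ] ℝ :=
  let Θ : E → E →L[ℝ] ℝ := fun y =>
    (θ ((extChartAt I x).symm y)).comp
      (mfderivWithin 𝓘(ℝ, E) I (extChartAt I x).symm (range I) y)
  let D : E →L[ℝ] E →L[ℝ] ℝ := fderivWithin ℝ Θ (range I) (extChartAt I x x)
  let A : E →L[ℝ] E := mfderiv I 𝓘(ℝ, E) (extChartAt I x) x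
  let B : E →L[ℝ] E →L[ℝ] ℝ := (D - D.flip).bilinearComp A A
  B

variable [IsManifold I 1 M]

/-- The Liouville one-form on `T^*M`: `⟨θ(α), X⟩ = ⟨α, Tπ(X)⟩`. -/
def liouvilleForm (a : CotangentBundle I M) :
    TangentSpace I.cotangent a →L[ℝ] ℝ :=
  a.snd.comp (mfderiv I.cotangent I
    (fun b : CotangentBundle I M => b.proj) a)

/-- The canonical symplectic form `ω = -dθ` of `T^*M`, in the form of the musical map
`ω^♭ : X ↦ i_X ω`. -/
def symplecticForm (a : CotangentBundle I M) :
    TangentSpace I.cotangent a →L[ℝ]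
      TangentSpace I.cotangent a →L[ℝ] ℝ :=
  -oneFormExtDeriv I.cotangent (liouvilleForm I) a

/-- The Hamiltonian vector field `X_H = ω^♯ (dH)`, where `ω^♯ = (ω^♭)⁻¹`; equivalently
`i_{X_H} ω = dH`. -/
def hamiltonianVectorField (Ham : CotangentBundle I M → ℝ) (a : CotangentBundle I M) :
    TangentSpace I.cotangent a :=
  (symplecticForm I a).inverse (mfderiv I.cotangent 𝓘(ℝ, ℝ) Ham a)

end General

section SymplecticForm

/- The canonical symplectic form is `dq ∧ dp` and it is nondegenerate, so that the inverse in the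
definition of `hamiltonianVectorField` is a genuine one and `i_{X_H} ω = dH` holds. -/

variable {E : Type*} [NormedAddCommGroup E] [NormedSpace ℝ E]
  {Q : Type*} [TopologicalSpace Q] [ChartedSpace E Q] [IsManifold 𝓘(ℝ, E) ∞ Q]


/-- In the natural chart at `a₀` the Liouville form is `p dq`. -/
theorem liouvilleForm_chart (a₀ : CotangentBundle 𝓘(ℝ, E) Q) (y : E × (E →L[ℝ] ℝ))
    (hy : y ∈ (extChartAt 𝓘(ℝ, E).cotangent a₀).target) (u : E × (E →L[ℝ] ℝ)) :
    liouvilleForm 𝓘(ℝ, E) ((extChartAt 𝓘(ℝ, E).cotangent a₀).symm y)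
      (mfderivWithin 𝓘(ℝ, E × (E →L[ℝ] ℝ)) 𝓘(ℝ, E).cotangent (extChartAt 𝓘(ℝ, E).cotangent a₀).symm (range 𝓘(ℝ, E).cotangent) y u) = y.2 u.1 := by
  set b := (extChartAt 𝓘(ℝ, E).cotangent a₀).symm y with hb
  have hrange : range 𝓘(ℝ, E).cotangent = univ := by simp
  have hy1 : y.1 ∈ (extChartAt 𝓘(ℝ, E) a₀.proj).target := by
    rw [FiberBundle.extChartAt_target] at hy; exact hy.1.1
  have hproj : ∀ z ∈ (extChartAt 𝓘(ℝ, E).cotangent a₀).target, ((extChartAt 𝓘(ℝ, E).cotangent a₀).symm z).proj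
      = (extChartAt 𝓘(ℝ, E) a₀.proj).symm z.1 := by
    intro z hz
    rw [FiberBundle.extChartAt_target] at hz
    rw [FiberBundle.extChartAt]
    exact (trivializationAt (E →L[ℝ] ℝ)
      (fun x : Q => TangentSpace 𝓘(ℝ, E) x →L[ℝ] ℝ) a₀.proj).proj_symm_apply'
        (b := (extChartAt 𝓘(ℝ, E) a₀.proj).symm z.1) (x := z.2) hz.1.2
  have hbsrc : b.proj ∈ (chartAt E a₀.proj).source := by
    rw [hproj y hy]
    have := (extChartAt 𝓘(ℝ, E) a₀.proj).map_target hy1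
    simpa using this
  have hcoord : (trivializationAt (E →L[ℝ] ℝ) (fun x : Q => TangentSpace 𝓘(ℝ, E) x →L[ℝ] ℝ) a₀.proj b).2 = y.2 := by
    have h := (extChartAt 𝓘(ℝ, E).cotangent a₀).right_inv hy
    rw [← hb, FiberBundle.extChartAt] at h
    exact congrArg Prod.snd h
  rw [hom_trivializationAt_apply] at hcoord
  have hs := TangentBundle.symmL_trivializationAt (𝕜 := ℝ) (I := 𝓘(ℝ, E)) (x₀ := a₀.proj) (x := b.proj) hbsrc
  have hcomp : (mfderiv 𝓘(ℝ, E).cotangent 𝓘(ℝ, E) (fun b : CotangentBundle 𝓘(ℝ, E) Q => b.proj) b)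
      (mfderivWithin 𝓘(ℝ, E × (E →L[ℝ] ℝ)) 𝓘(ℝ, E).cotangent (extChartAt 𝓘(ℝ, E).cotangent a₀).symm (range 𝓘(ℝ, E).cotangent) y u)
      = mfderivWithin 𝓘(ℝ, E) 𝓘(ℝ, E) (extChartAt 𝓘(ℝ, E) a₀.proj).symm (range 𝓘(ℝ, E)) y.1 u.1 := by
    have hd : MDifferentiableWithinAt 𝓘(ℝ, E × (E →L[ℝ] ℝ)) 𝓘(ℝ, E).cotangent
        (extChartAt 𝓘(ℝ, E).cotangent a₀).symm (range 𝓘(ℝ, E).cotangent) y :=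
      mdifferentiableWithinAt_extChartAt_symm hy
    have hp : MDifferentiableAt 𝓘(ℝ, E).cotangent 𝓘(ℝ, E)
        (fun b : CotangentBundle 𝓘(ℝ, E) Q => b.proj) b := mdifferentiableAt_proj _
    have hd' : MDifferentiableWithinAt 𝓘(ℝ, E) 𝓘(ℝ, E)
        (extChartAt 𝓘(ℝ, E) a₀.proj).symm (range 𝓘(ℝ, E)) y.1 :=
      mdifferentiableWithinAt_extChartAt_symm hy1
    rw [hrange] at hd ⊢
    have hr' : range 𝓘(ℝ, E) = univ := by simp
    rw [hr'] at hd' ⊢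
    rw [mfderivWithin_univ, mfderivWithin_univ]
    rw [mdifferentiableWithinAt_univ] at hd hd'
    have e1 := mfderiv_comp_apply y hp hd u
    refine e1.symm.trans ?_
    have hev : ((fun b : CotangentBundle 𝓘(ℝ, E) Q => b.proj) ∘ (extChartAt 𝓘(ℝ, E).cotangent a₀).symm)
        =ᶠ[𝓝 y] (extChartAt 𝓘(ℝ, E) a₀.proj).symm ∘ Prod.fst := by
      have : (extChartAt 𝓘(ℝ, E).cotangent a₀).target ∈ 𝓝 y :=
        extChartAt_target_mem_nhds' hy
      filter_upwards [this] with z hz using hproj z hz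
    have e2 := hev.mfderiv_eq (I := 𝓘(ℝ, E × (E →L[ℝ] ℝ))) (I' := 𝓘(ℝ, E))
    have e3 := congrArg (fun L => (L u : E)) e2
    refine e3.trans ?_
    have hf : MDifferentiableAt 𝓘(ℝ, E × (E →L[ℝ] ℝ)) 𝓘(ℝ, E) (Prod.fst : E × (E →L[ℝ] ℝ) → E) y :=
      mdifferentiableAt_iff_differentiableAt.2 differentiableAt_fst
    have e4 := mfderiv_comp_apply y (g := (extChartAt 𝓘(ℝ, E) a₀.proj).symm) hd' hf u
    refine e4.trans ?_
    rw [mfderiv_eq_fderiv, fderiv_fst]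
    rfl
  rw [liouvilleForm]
  change b.snd _ = _
  rw [← hcoord]
  refine (congrArg b.snd hcomp).trans ?_
  have hpe : extChartAt 𝓘(ℝ, E) a₀.proj b.proj = y.1 := by
    rw [hproj y hy]; exact (extChartAt 𝓘(ℝ, E) a₀.proj).right_inv hy1
  rw [hpe] at hs
  rw [ContinuousLinearMap.inCoordinates, hs]
  simp
  rfl


theorem oneFormExtDeriv_apply_of_eventually {V : Type*} [NormedAddCommGroup V] [NormedSpace ℝ V]
    {K : Type*} [TopologicalSpace K] (I : ModelWithCorners ℝ V K) (hI : range I = univ)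
    {M : Type*} [TopologicalSpace M] [ChartedSpace K M] [IsManifold I 1 M]
    (θ : ∀ x : M, TangentSpace I x →L[ℝ] ℝ) (x : M) (Λ : V →L[ℝ] V →L[ℝ] ℝ)
    (hΛ : ∀ y ∈ (extChartAt I x).target, ∀ u : V, θ ((extChartAt I x).symm y)
      (mfderivWithin 𝓘(ℝ, V) I (extChartAt I x).symm (range I) y u) = Λ y u) (u v : V) :
    oneFormExtDeriv I θ x u v = Λ u v - Λ v u := by
  let Θ : V → V →L[ℝ] ℝ := fun y => (θ ((extChartAt I x).symm y)).comp
      (mfderivWithin 𝓘(ℝ, V) I (extChartAt I x).symm (range I) y)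
  have hev : Θ =ᶠ[𝓝 (extChartAt I x x)] Λ := by
    have := extChartAt_target_mem_nhdsWithin (I := I) x
    rw [hI, nhdsWithin_univ] at this
    filter_upwards [this] with y hy
    exact ContinuousLinearMap.ext fun u => hΛ y hy u
  have hD : fderivWithin ℝ Θ (range I) (extChartAt I x x) = Λ := by
    rw [hI, fderivWithin_univ, hev.fderiv_eq]; exact Λ.fderiv
  let A : V →L[ℝ] V := mfderiv I 𝓘(ℝ, V) (extChartAt I x) x
  have hA : A = .id ℝ V := by
    have h := TangentBundle.continuousLinearMapAt_trivializationAt (𝕜 := ℝ)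
      (I := I) (x₀ := x) (x := x) (mem_chart_source _ x)
    refine h.symm.trans ?_
    rw [TangentBundle.continuousLinearMapAt_trivializationAt_eq_core (mem_chart_source _ x)]
    refine ContinuousLinearMap.ext fun u => ?_
    exact (tangentBundleCore I M).coordChange_self
      (achart _ x) x (mem_chart_source _ x) u
  change fderivWithin ℝ Θ (range I) (extChartAt I x x) (A u) (A v) -
    fderivWithin ℝ Θ (range I) (extChartAt I x x) (A v) (A u) = _
  rw [hD, hA]
  rfl

/-- `ω = dq ∧ dp` in natural coordinates. -/
theorem symplecticForm_apply (a : CotangentBundle 𝓘(ℝ, E) Q) (u v : E × (E →L[ℝ] ℝ)) :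
    symplecticForm 𝓘(ℝ, E) a u v = v.2 u.1 - u.2 v.1 := by
  let Λ : (E × (E →L[ℝ] ℝ)) →L[ℝ] (E × (E →L[ℝ] ℝ)) →L[ℝ] ℝ :=
    ((ContinuousLinearMap.compL ℝ (E × (E →L[ℝ] ℝ)) E ℝ).flip (.fst ℝ E (E →L[ℝ] ℝ))).comp
      (.snd ℝ E (E →L[ℝ] ℝ))
  have h := oneFormExtDeriv_apply_of_eventually 𝓘(ℝ, E).cotangent (by simp)
    (liouvilleForm 𝓘(ℝ, E)) a Λ (fun y hy u => liouvilleForm_chart a y hy u) u v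
  change -(oneFormExtDeriv 𝓘(ℝ, E).cotangent (liouvilleForm 𝓘(ℝ, E)) a u v) = _
  rw [h]
  change -(u.2 v.1 - v.2 u.1) = _
  ring

theorem bilinear_isInvertible {V : Type*} [NormedAddCommGroup V] [NormedSpace ℝ V]
    [FiniteDimensional ℝ V] (B : V →L[ℝ] V →L[ℝ] ℝ) (hinj : Function.Injective B) :
    B.IsInvertible := by
  have hfin : Module.finrank ℝ V = Module.finrank ℝ (V →L[ℝ] ℝ) := by
    rw [(LinearMap.toContinuousLinearMap (𝕜 := ℝ) (E := V) (F' := ℝ)).finrank_eq.symm]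
    exact (Subspace.dual_finrank_eq (K := ℝ) (V := V)).symm
  exact ⟨(LinearEquiv.ofInjectiveOfFinrankEq B.toLinearMap hinj hfin).toContinuousLinearEquiv, rfl⟩

set_option synthInstance.maxHeartbeats 400000 in
theorem symplecticForm_isInvertible [FiniteDimensional ℝ E] (a : CotangentBundle 𝓘(ℝ, E) Q) :
    (symplecticForm 𝓘(ℝ, E) a).IsInvertible := by
  let B : (E × (E →L[ℝ] ℝ)) →L[ℝ] (E × (E →L[ℝ] ℝ)) →L[ℝ] ℝ := symplecticForm 𝓘(ℝ, E) a
  have hB : ∀ u v, B u v = v.2 u.1 - u.2 v.1 := symplecticForm_apply a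
  have hinj : Function.Injective B := by
    rw [injective_iff_map_eq_zero]
    intro u hu
    have h : ∀ v : E × (E →L[ℝ] ℝ), v.2 u.1 - u.2 v.1 = 0 := fun v => by rw [← hB, hu]; rfl
    have h1 : u.1 = 0 := by
      by_contra hne
      obtain ⟨g, hg⟩ := SeparatingDual.exists_ne_zero (R := ℝ) hne
      exact hg (by simpa using h (0, g))
    have h2 : u.2 = 0 := by
      ext x; simpa using h (x, 0)
    exact Prod.ext h1 h2
  exact bilinear_isInvertible B hinj

/-- The Hamiltonian vector field satisfies `i_{X_H} ω = dH`. -/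
theorem hamiltonianVectorField_spec [FiniteDimensional ℝ E] (Ham : CotangentBundle 𝓘(ℝ, E) Q → ℝ)
    (a : CotangentBundle 𝓘(ℝ, E) Q) :
    symplecticForm 𝓘(ℝ, E) a (hamiltonianVectorField 𝓘(ℝ, E) Ham a) =
      mfderiv 𝓘(ℝ, E).cotangent 𝓘(ℝ, ℝ) Ham a :=
  (((symplecticForm_isInvertible a).inverse_apply_eq).1 rfl).symm

end SymplecticForm

section Lift

variable {E : Type*} [NormedAddCommGroup E] [NormedSpace ℝ E]
  {H : Type*} [TopologicalSpace H] (I : ModelWithCorners ℝ E H)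
  {M : Type*} [TopologicalSpace M] [ChartedSpace H M] [IsManifold I 1 M]

/-- The canonical isomorphism `α_M : TT^*M → T^*TM`, in natural coordinates
`(q, p, q̇, ṗ) ↦ (q, q̇, ṗ, p)`: the image of a vector with components `(q̇, ṗ)` at the covector `p_q` is
the covector `(δq, δv) ↦ ṗ δq + p δv` at the vector `q̇` of `T_q M`. Mathlib expresses a tangent
vector to `M`, `TM` or `T^*M` at a point over `q` in the natural coordinates induced by the preferred
chart of `M` at `q`; these are the coordinates used here on all spaces. -/
def tulczyjew (w : TangentBundle I.cotangent (CotangentBundle I M)) :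
    CotangentBundle I.tangent (TangentBundle I M) :=
  let q : M := w.proj.proj
  let p : E →L[ℝ] ℝ := w.proj.snd
  let w' : E × (E →L[ℝ] ℝ) := w.snd
  ⟨⟨q, w'.1⟩, (w'.2.coprod p : E × E →L[ℝ] ℝ)⟩

/-- The diffeomorphism `Φ : T^*M × T^*M → T^*(M × M)`, `(q₀, p₀; q₁, p₁) ↦ (q₀, q₁, -p₀, p₁)`. -/
def cotangentProdEquiv :
    CotangentBundle I M × CotangentBundle I M ≃ CotangentBundle (I.prod I) (M × M) where
  toFun a := ⟨(a.1.proj, a.2.proj),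
    ((-(a.1.snd : E →L[ℝ] ℝ)).coprod (a.2.snd : E →L[ℝ] ℝ) : E × E →L[ℝ] ℝ)⟩
  invFun b :=
    (⟨b.proj.1, -((b.snd : E × E →L[ℝ] ℝ).comp (ContinuousLinearMap.inl ℝ E E))⟩,
      ⟨b.proj.2, (b.snd : E × E →L[ℝ] ℝ).comp (ContinuousLinearMap.inr ℝ E E)⟩)
  left_inv := by
    rintro ⟨⟨q, p⟩, ⟨q', p'⟩⟩
    have h₁ : ∀ a b : E →L[ℝ] ℝ, -(((-a).coprod b).comp (.inl ℝ E E)) = a := by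
      intro a b; ext; simp
    have h₂ : ∀ a b : E →L[ℝ] ℝ, ((-a).coprod b).comp (.inr ℝ E E) = b := by
      intro a b; ext; simp
    exact Prod.ext (congrArg (TotalSpace.mk q) (h₁ p p')) (congrArg (TotalSpace.mk q') (h₂ p p'))
  right_inv := by
    rintro ⟨⟨q, q'⟩, p⟩
    have h : ∀ c : E × E →L[ℝ] ℝ,
        (-(-(c.comp (.inl ℝ E E)))).coprod (c.comp (.inr ℝ E E)) = c := by
      intro c; ext <;> simp
    exact congrArg (TotalSpace.mk (q, q')) (h p)

/-- The cotangent lift `R^{T^*} = Φ⁻¹ ∘ R̂ ∘ α_M : TT^*M → T^*M × T^*M` of `R : TM → M × M`. -/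
def discretizationCotangentLift (R : TangentBundle I M → M × M)
    (w : TangentBundle I.cotangent (CotangentBundle I M)) :
    CotangentBundle I M × CotangentBundle I M :=
  (cotangentProdEquiv I).symm (cotangentLift I.tangent (I.prod I) R (tulczyjew I w))

/-- The domain of `R^{T^*}` for `R : U ⊆ TM → M × M`: the vectors `w` lying over a vector of `U` at
which `R` is a local diffeomorphism, that is, where its tangent map is invertible. -/
def discretizationCotangentLiftDomain (U : Set (TangentBundle I M))
    (R : TangentBundle I M → M × M) :
    Set (TangentBundle I.cotangent (CotangentBundle I M)) :=
  {w | (tulczyjew I w).proj ∈ U ∧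
    (mfderiv I.tangent (I.prod I) R (tulczyjew I w).proj).IsInvertible}

/-- `L^h`, the set of pairs `(α, β)` such that `(α, β) = R^{T^*} (h X_H(γ))` for some `γ ∈ T^*M` with
`h X_H(γ)` in the domain of `R^{T^*}`. -/
def integratorRelation (U : Set (TangentBundle I M)) (R : TangentBundle I M → M × M)
    (Ham : CotangentBundle I M → ℝ) (h : ℝ) :
    Set (CotangentBundle I M × CotangentBundle I M) :=
  {ab | ∃ γ : CotangentBundle I M,
    TangentBundle.smulFiber _ h ⟨γ, hamiltonianVectorField I Ham γ⟩
        ∈ discretizationCotangentLiftDomain I U R ∧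
      ab = discretizationCotangentLift I R
        (TangentBundle.smulFiber _ h ⟨γ, hamiltonianVectorField I Ham γ⟩)}

/-- The transpose `L^† = {(α, β) | (β, α) ∈ L}`. -/
def relationTranspose {X : Type*} (L : Set (X × X)) : Set (X × X) :=
  {ab | (ab.2, ab.1) ∈ L}

end Lift

end

/-! ### Fibrewise negation on a tangent bundle and its differential -/

section NegFiber

variable {E : Type*} [NormedAddCommGroup E] [NormedSpace ℝ E]
  {H : Type*} [TopologicalSpace H] (I : ModelWithCorners ℝ E H)
  {M : Type*} [TopologicalSpace M] [ChartedSpace H M]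

/-! The cotangent lift turns `-w` into an exchange of factors: `R^{T^*}(-w) = (R^{T^*}(w)).swap`
(`discretizationCotangentLift_negFiber`). Write `N (δq, δv) = (δq, -δv)` for the differential of
negation. Differentiating `R = ι ∘ R ∘ (-1)` gives `T_{-x} R = Tι ∘ T_x R ∘ N`
(`mfderiv_negFiber_eq`). If `c = (ṗ, p)` is the covector of `α_Q(w)`, that of `α_Q(-w)` is `(-ṗ, p)
= -c ∘ N`. The two copies of `N` cancel, and `R̂` yields `-c ∘ (T_x R)⁻¹ ∘ Tι`: components
exchanged, overall sign reversed. That sign is what the asymmetric sign in `Φ` requires. With `w = h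
X_H(γ)`, the same `γ` then witnesses the swapped pair for `-h`. -/

theorem TangentBundle.negFiber_negFiber (v : TangentBundle I M) :
    TangentBundle.negFiber I (TangentBundle.negFiber I v) = v :=
  congrArg (TotalSpace.mk v.proj) (neg_neg v.snd)

theorem TangentBundle.negFiber_smulFiber (c : ℝ) (v : TangentBundle I M) :
    TangentBundle.negFiber I (TangentBundle.smulFiber I c v) = TangentBundle.smulFiber I (-c) v :=
  congrArg (TotalSpace.mk v.proj) (neg_smul c v.snd).symm

variable [IsManifold I 1 M]

/-- The fibre coordinate of a trivialization commutes with fibrewise negation. -/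
theorem TangentBundle.trivializationAt_negFiber (x₀ : M) {v : TangentBundle I M}
    (hv : v.proj ∈ (trivializationAt E (TangentSpace I) x₀).baseSet) :
    (trivializationAt E (TangentSpace I) x₀ (TangentBundle.negFiber I v)).2 =
      -(trivializationAt E (TangentSpace I) x₀ v).2 :=
  ((trivializationAt E (TangentSpace I) x₀).linear ℝ hv).mk' _ |>.map_neg v.snd

/-- `HasMFDerivAt` includes continuity, so this is needed separately. Near each vector the base
point is unchanged and the fibre coordinate is negated. -/
theorem TangentBundle.continuous_negFiber :
    Continuous (TangentBundle.negFiber I : TangentBundle I M → TangentBundle I M) := by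
  rw [continuous_iff_continuousAt]
  intro v
  have hproj : Continuous (fun w : TangentBundle I M => w.proj) :=
    FiberBundle.continuous_proj E (TangentSpace I)
  refine (FiberBundle.continuousAt_totalSpace E _).2
    ⟨hproj.continuousAt, ?_⟩
  have hbase : ∀ᶠ w : TangentBundle I M in 𝓝 v,
      w.proj ∈ (trivializationAt E (TangentSpace I) v.proj).baseSet :=
    hproj.continuousAt.eventually
      ((trivializationAt E (TangentSpace I) v.proj).open_baseSet.mem_nhds
        (mem_baseSet_trivializationAt E (TangentSpace I) v.proj))
  have hc : ContinuousAt
      (fun w => -(trivializationAt E (TangentSpace I) v.proj w).2) v :=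
    ((FiberBundle.continuousAt_totalSpace E id).1 continuousAt_id).2.neg
  exact hc.congr (hbase.mono fun w hw =>
    (TangentBundle.trivializationAt_negFiber I v.proj hw).symm)

/-- The differential of fibrewise negation is `(δq, δv) ↦ (δq, -δv)` in natural coordinates. -/
theorem TangentBundle.hasMFDerivAt_negFiber (v : TangentBundle I M) :
    HasMFDerivAt I.tangent I.tangent (TangentBundle.negFiber I) v
      ((ContinuousLinearMap.id ℝ E).prodMap (-ContinuousLinearMap.id ℝ E) : E × E →L[ℝ] E × E) := by
  refine ⟨(TangentBundle.continuous_negFiber I).continuousAt, ?_⟩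
  let N : E × E →L[ℝ] E × E := (ContinuousLinearMap.id ℝ E).prodMap (-ContinuousLinearMap.id ℝ E)
  -- The charts at `v` and `-v` depend only on the common base point, so negation read in them is
  -- the linear map `N` on the whole chart target.
  have hN : ∀ y ∈ (extChartAt I.tangent v).target,
      writtenInExtChartAt I.tangent I.tangent v (TangentBundle.negFiber I) y = N y := by
    intro y hy
    have hz := (extChartAt I.tangent v).map_target hy
    have hr := (extChartAt I.tangent v).right_inv hy
    set w := (extChartAt I.tangent v).symm y with hw
    rw [extChartAt_source, FiberBundle.chartedSpace_chartAt] at hz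
    have hbase : w.proj ∈ (trivializationAt E (TangentSpace I) v.proj).baseSet :=
      ((trivializationAt E (TangentSpace I) v.proj).mem_source).1 hz.1
    change extChartAt I.tangent (TangentBundle.negFiber I v) (TangentBundle.negFiber I w) = N y
    rw [← hr]
    rw [FiberBundle.extChartAt, FiberBundle.extChartAt]
    refine Prod.ext ?_ (TangentBundle.trivializationAt_negFiber I v.proj hbase)
    change extChartAt I v.proj (trivializationAt E (TangentSpace I) v.proj _).1 =
      extChartAt I v.proj (trivializationAt E (TangentSpace I) v.proj _).1
    rw [Trivialization.coe_fst' _ hbase, Trivialization.coe_fst' _ (by exact hbase)]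
    rfl
  refine N.hasFDerivAt.hasFDerivWithinAt.congr_of_eventuallyEq ?_
    (hN _ (mem_extChartAt_target v))
  filter_upwards [extChartAt_target_mem_nhdsWithin (I := I.tangent) v] with y hy using hN y hy

end NegFiber

/-! ### Symmetry of the cotangent lift and of the integrator -/

section SymmetricLift

variable {E : Type*} [NormedAddCommGroup E] [NormedSpace ℝ E]
  {H : Type*} [TopologicalSpace H] (I : ModelWithCorners ℝ E H)
  {M : Type*} [TopologicalSpace M] [ChartedSpace H M]

theorem hasMFDerivAt_prodSwap (z : M × M) :
    HasMFDerivAt (I.prod I) (I.prod I) (Prod.swap : M × M → M × M) z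
      (ContinuousLinearEquiv.prodComm ℝ E E : E × E →L[ℝ] E × E) :=
  (hasMFDerivAt_snd z).prodMk (hasMFDerivAt_fst z)

variable {I} [IsManifold I 1 M] {U : Set (TangentBundle I M)} {R : TangentBundle I M → M × M}

/-- If `R v = ι (R (-v))` on the open set `U`, then `T_{-v} R = T ι ∘ T_v R ∘ T (-1)`. -/
theorem mfderiv_negFiber_eq (hU : IsOpen U)
    (hR : ContMDiffOn I.tangent (I.prod I) ∞ R U)
    (hsymm : ∀ v ∈ U, TangentBundle.negFiber I v ∈ U ∧
      R v = Prod.swap (R (TangentBundle.negFiber I v)))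
    {v : TangentBundle I M} (hv : v ∈ U) :
    (mfderiv I.tangent (I.prod I) R (TangentBundle.negFiber I v) : E × E →L[ℝ] E × E) =
      (ContinuousLinearEquiv.prodComm ℝ E E : E × E →L[ℝ] E × E).comp
        ((mfderiv I.tangent (I.prod I) R v : E × E →L[ℝ] E × E).comp
          ((ContinuousLinearMap.id ℝ E).prodMap (-ContinuousLinearMap.id ℝ E))) := by
  have hRv : HasMFDerivAt I.tangent (I.prod I) R v (mfderiv I.tangent (I.prod I) R v) :=
    ((hR.contMDiffAt (hU.mem_nhds hv)).mdifferentiableAt (by simp)).hasMFDerivAt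
  have hn := TangentBundle.hasMFDerivAt_negFiber I (TangentBundle.negFiber I v)
  -- The chain rule at `-v` meets `R` at `-(-v)`, which is `v` only propositionally.
  have hRn : HasMFDerivAt I.tangent (I.prod I) R
      (TangentBundle.negFiber I (TangentBundle.negFiber I v))
      (mfderiv I.tangent (I.prod I) R v : E × E →L[ℝ] E × E) := by
    rw [TangentBundle.negFiber_negFiber]; exact hRv
  have hc := (hasMFDerivAt_prodSwap I _).comp _ (hRn.comp _ hn)
  -- The symmetry identity can be differentiated because it holds on a neighbourhood of `-v`, namely
  -- `U`.
  have hev : R =ᶠ[𝓝 (TangentBundle.negFiber I v)]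
      Prod.swap ∘ R ∘ TangentBundle.negFiber I := by
    filter_upwards [hU.mem_nhds (hsymm v hv).1] with w hw using (hsymm w hw).2
  exact (hc.congr_of_eventuallyEq hev).mfderiv

/-- If `w` lies over `x`, then `-w` lies over `-x`, where the differential of `R` is a composite of
three isomorphisms. -/
theorem negFiber_mem_discretizationCotangentLiftDomain (hU : IsOpen U)
    (hR : ContMDiffOn I.tangent (I.prod I) ∞ R U)
    (hsymm : ∀ v ∈ U, TangentBundle.negFiber I v ∈ U ∧
      R v = Prod.swap (R (TangentBundle.negFiber I v)))
    {w : TangentBundle I.cotangent (CotangentBundle I M)}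
    (hw : w ∈ discretizationCotangentLiftDomain I U R) :
    TangentBundle.negFiber I.cotangent w ∈ discretizationCotangentLiftDomain I U R := by
  refine ⟨(hsymm _ hw.1).1, ?_⟩
  obtain ⟨e, he⟩ := hw.2
  let e' : (E × E) ≃L[ℝ] (E × E) := e
  refine ⟨(((ContinuousLinearEquiv.refl ℝ E).prodCongr (ContinuousLinearEquiv.neg ℝ)).trans
    e').trans (ContinuousLinearEquiv.prodComm ℝ E E), ?_⟩
  refine Eq.trans ?_ (mfderiv_negFiber_eq hU hR hsymm hw.1).symm
  rw [← he]
  rfl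

/-- The cotangent lift of a symmetric discretization map intertwines fibrewise negation on
`TT^*M` with the exchange of factors on `T^*M × T^*M`. -/
theorem discretizationCotangentLift_negFiber (hU : IsOpen U)
    (hR : ContMDiffOn I.tangent (I.prod I) ∞ R U)
    (hsymm : ∀ v ∈ U, TangentBundle.negFiber I v ∈ U ∧
      R v = Prod.swap (R (TangentBundle.negFiber I v)))
    {w : TangentBundle I.cotangent (CotangentBundle I M)}
    (hw : w ∈ discretizationCotangentLiftDomain I U R) :
    discretizationCotangentLift I R (TangentBundle.negFiber I.cotangent w) =
      (discretizationCotangentLift I R w).swap := by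
  set x : TangentBundle I M := (tulczyjew I w).proj with hx
  obtain ⟨e, he⟩ := hw.2
  let e' : (E × E) ≃L[ℝ] (E × E) := e
  let n : (E × E) ≃L[ℝ] (E × E) :=
    (ContinuousLinearEquiv.refl ℝ E).prodCongr (ContinuousLinearEquiv.neg ℝ)
  let s : (E × E) ≃L[ℝ] (E × E) := ContinuousLinearEquiv.prodComm ℝ E E
  let p : E →L[ℝ] ℝ := w.proj.snd
  let w' : E × (E →L[ℝ] ℝ) := w.snd
  let c : E × E →L[ℝ] ℝ := w'.2.coprod p
  -- Negation in `TT^*M` flips `ṗ` but keeps the base covector `p`; hence `c' = -c ∘ n`.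
  let c' : E × E →L[ℝ] ℝ := (-w'.2).coprod p
  let T : E × E →L[ℝ] E × E := mfderiv I.tangent (I.prod I) R x
  let T' : E × E →L[ℝ] E × E := mfderiv I.tangent (I.prod I) R (TangentBundle.negFiber I x)
  have hT : T.inverse = (e'.symm : E × E →L[ℝ] E × E) := by
    have : T = (e' : E × E →L[ℝ] E × E) := he.symm
    rw [this, ContinuousLinearMap.inverse_equiv]
  have hT' : T'.inverse = (((n.trans e').trans s).symm : E × E →L[ℝ] E × E) := by
    have : T' = ((n.trans e').trans s : E × E →L[ℝ] E × E) := by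
      refine (mfderiv_negFiber_eq hU hR hsymm hw.1).trans ?_
      rw [← he]
      rfl
    rw [this, ContinuousLinearMap.inverse_equiv]
  have hcov : ∀ u : E × E, c' (T'.inverse u) = -c (T.inverse u.swap) := by
    intro u
    rw [hT, hT']
    change (-w'.2) (e'.symm u.swap).1 + p (-(e'.symm u.swap).2) =
      -(w'.2 (e'.symm u.swap).1 + p (e'.symm u.swap).2)
    rw [map_neg, neg_add]
    rfl
  have hbase : R (TangentBundle.negFiber I x) = (R x).swap := by
    rw [(hsymm x hw.1).2, Prod.swap_swap]
  -- `Φ⁻¹` negates only the first component: here its sign cancels the one in `hcov`, while in `h₂`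
  -- the sign of `hcov` supplies the negation.
  have h₁ : -((c'.comp T'.inverse).comp (ContinuousLinearMap.inl ℝ E E)) =
      (c.comp T.inverse).comp (ContinuousLinearMap.inr ℝ E E) := by
    ext u
    change -(c' (T'.inverse (u, 0))) = c (T.inverse (0, u))
    rw [hcov, neg_neg, Prod.swap_prod_mk]
  have h₂ : (c'.comp T'.inverse).comp (ContinuousLinearMap.inr ℝ E E) =
      -((c.comp T.inverse).comp (ContinuousLinearMap.inl ℝ E E)) := by
    ext u
    change c' (T'.inverse (0, u)) = -(c (T.inverse (u, 0)))
    rw [hcov, Prod.swap_prod_mk]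
  -- All cotangent fibres are the same space `E →L[ℝ] ℝ`, so base points and covectors can be
  -- compared separately, without transport.
  have key : ∀ (a b : M) (f g : E →L[ℝ] ℝ), a = b → f = g →
      (⟨a, f⟩ : CotangentBundle I M) = ⟨b, g⟩ := by
    rintro a _ f _ rfl rfl
    rfl
  exact Prod.ext (key _ _ _ _ (congrArg Prod.fst hbase) h₁)
    (key _ _ _ _ (congrArg Prod.snd hbase) h₂)

theorem swap_mem_integratorRelation_neg (hU : IsOpen U)
    (hR : ContMDiffOn I.tangent (I.prod I) ∞ R U)
    (hsymm : ∀ v ∈ U, TangentBundle.negFiber I v ∈ U ∧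
      R v = Prod.swap (R (TangentBundle.negFiber I v)))
    {Ham : CotangentBundle I M → ℝ} {h : ℝ} {z : CotangentBundle I M × CotangentBundle I M}
    (hz : z ∈ integratorRelation I U R Ham h) :
    z.swap ∈ integratorRelation I U R Ham (-h) := by
  obtain ⟨γ, hγ, rfl⟩ := hz
  refine ⟨γ, ?_, ?_⟩
  · rw [← TangentBundle.negFiber_smulFiber]
    exact negFiber_mem_discretizationCotangentLiftDomain hU hR hsymm hγ
  · rw [← TangentBundle.negFiber_smulFiber]
    exact (discretizationCotangentLift_negFiber hU hR hsymm hγ).symm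

end SymmetricLift

theorem mainTheorem10
    {E : Type*} [NormedAddCommGroup E] [NormedSpace ℝ E] [FiniteDimensional ℝ E]
    {Q : Type*} [TopologicalSpace Q] [ChartedSpace E Q] [IsManifold 𝓘(ℝ, E) ∞ Q]
    (U : Set (TangentBundle 𝓘(ℝ, E) Q)) (R : TangentBundle 𝓘(ℝ, E) Q → Q × Q)
    (hR : IsDiscretizationMap 𝓘(ℝ, E) U R)
    (hsymm : ∀ v ∈ U, TangentBundle.negFiber 𝓘(ℝ, E) v ∈ U ∧
      R v = Prod.swap (R (TangentBundle.negFiber 𝓘(ℝ, E) v)))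
    (Ham : CotangentBundle 𝓘(ℝ, E) Q → ℝ)
    (hHam : ContMDiff 𝓘(ℝ, E).cotangent 𝓘(ℝ, ℝ) ∞ Ham)
    (h : ℝ) :
    relationTranspose (integratorRelation 𝓘(ℝ, E) U R Ham h) =
      integratorRelation 𝓘(ℝ, E) U R Ham (-h) := by
  ext z
  constructor
  · intro hz
    exact swap_mem_integratorRelation_neg hR.isOpen hR.contMDiffOn hsymm hz
  · intro hz
    -- The reverse inclusion is the same statement taken at `-h`.
    have h' := swap_mem_integratorRelation_neg hR.isOpen hR.contMDiffOn hsymm hz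
    rwa [neg_neg] at h'
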